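/- Setting. Let $G=(X,w,\kappa,\mu)$ be a weighted graph: $X$ is a countable set, $w\colon X\times X\to[0,\infty)$ is symmetric with $w(x,x)=0$ and $\sum_{y}w(x,y)<\infty$ for all $x$, $\kappa\colon X\to[0,\infty)$ and $\mu\colon X\to(0,\infty)$. Write $x\sim y$ if $w(x,y)\neq 0$. $G$ is connected if any two nodes are joined by a finite walk $x_0\sim x_1\sim\dots\sim x_n$. Condition (IP): $\sum_n\mu(x_n)=\infty$ for every infinite path, i.e. every sequence $(x_n)_{n\ge 0}$ of pairwise distinct nodes with $x_n\sim x_{n+1}$ for all $n$. For $1\le p<\infty$, $\ell^p(X,\mu)=\{u\colon X\to\mathbb R:\ \|u\|_p=(\sum_x|u(x)|^p\mu(x))^{1/p}<\infty\}$. Condition $(C_p)$: $\sum_{y}w(x,y)^p/\mu(y)^{p-1}<\infty$ for every $x\in X$. The graph Laplacian is $$\Delta u(x)=\frac1{\mu(x)}\sum_{y}w(x,y)\,(u(x)-u(y))+\frac{\kappa(x)}{\mu(x)}u(x)$$ on $\operatorname{dom}(\Delta)=\{u:\ \sum_y w(x,y)|u(y)|<\infty\ \text{for all }x\}$. For $f\colon\mathbb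 R\to\mathbb R$ put $\mathcal A u=\Delta u-f(u)$ with $\operatorname{dom}_p(\mathcal A)=\{u\in\ell^p(X,\mu)\cap\operatorname{dom}(\Delta):\ \mathcal A u\in\ell^p(X,\mu)\}$. Mild solutions. Let $0<T<\infty$, $h\in L^1_{\mathrm{loc}}([0,T];\ell^p(X,\mu))$ and $u_0\in\ell^p(X,\mu)$. For $\epsilon>0$, an $\epsilon$-discretization of $([0,T];h)$ consists of times $0=t_0<t_1<\dots<t_N\le T$ with $t_k-t_{k-1}\le\epsilon$ and $T-t_N\le\epsilon$, and of $h_1,\dots,h_N\in\ell^p(X,\mu)$ with $\sum_{k=1}^N\int_{t_{k-1}}^{t_k}\|h(t)-h_k\|_p\,dt\le\epsilon$. If $u_1,\dots,u_N\in\operatorname{dom}_p(\mathcal A)$ satisfy $u_k+(t_k-t_{k-1})\mathcal A u_k=u_{k-1}+(t_k-t_{k-1})h_k$ for $k=1,\dots,N$, the function $u_\epsilon$ on $[0,t_N]$ with $u_\epsilon(0)=u_0$ and $u_\epsilon=u_k$ on $(t_{k-1},t_k]$ is an $\epsilon$-approximate solution. A mild solution on $[0,T]$ of $\partial_t u+\mathcal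 A u=h$, $u(0)=u_0$, is a $u\in C([0,T];\ell^p(X,\mu))$ such that for every $\epsilon>0$ there are an $\epsilon$-discretization and an $\epsilon$-approximate solution $u_\epsilon$ subordinate to it with $\|u(t)-u_\epsilon(t)\|_p<\epsilon$ for all $t\in[0,t_N]$. If $T=\infty$, $[0,T]$ is read as $[0,\infty)$, and $u$ is a mild solution if its restriction to each $[0,a]$, $0<a<\infty$, is one. Theorem. Let $G$ be a connected graph satisfying (IP), let $1\le p<\infty$ and $0<T\le\infty$, and assume $(C_p)$ if $p>1$. Let $f\colon\mathbb R\to\mathbb R$ with $f(0)=0$ be either continuous and monotone decreasing (not necessarily strictly), or Lipschitz continuous with some constant $L>0$. Let $h,g\in L^1_{\mathrm{loc}}([0,T];\ell^p(X,\mu))$ and $u_0,v_0\in\ell^p(X,\mu)$, and let $u,v$ be mild solutions of $$\partial_t u+\mathcal A u=h,\quad u(0)=u_0\qquad\text{and}\qquad \partial_t v+\mathcal A v=g,\quad v(0)=v_0 .$$ If $u_0\le v_0$ pointwise on $X$ and $h(t)\le g(t)$ pointwise on $X$ for almost every $t\in[0,T]$, then $u(t)\le v(t)$ pointwise on $X$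 for all $t\in[0,T]$. -/

import Mathlib

open Set MeasureTheory

noncomputable section

/-- A weighted graph `(X, w, κ, μ)` on the node set `X` (countability of `X` is required
separately). -/
structure WeightedGraph (X : Type*) where
  /-- edge weights -/
  w : X → X → ℝ
  /-- killing term -/
  κ : X → ℝ
  /-- node measure -/
  μ : X → ℝ
  w_nonneg : ∀ x y, 0 ≤ w x y
  κ_nonneg : ∀ x, 0 ≤ κ x
  μ_pos : ∀ x, 0 < μ x
  w_symm : ∀ x y, w x y = w y x
  w_loopless : ∀ x, w x x = 0
  w_summable : ∀ x, Summable (fun y => w x y)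

namespace WeightedGraph

variable {X : Type*} (G : WeightedGraph X)

/-- The underlying simple graph: `x ∼ y` iff `w x y` is non-zero. -/
def toSimpleGraph : SimpleGraph X where
  Adj x y := G.w x y ≠ 0
  symm := ⟨fun x y h => by rwa [G.w_symm y x]⟩
  loopless := ⟨fun x h => h (G.w_loopless x)⟩

/-- Any two nodes are joined by a finite walk. -/
def IsConnected : Prop := G.toSimpleGraph.Preconnected

/-- Condition (IP): every infinite path (an infinite walk without repeated nodes) has
infinite measure. -/
def CondIP : Prop :=
  ∀ x : ℕ → X, Function.Injective x → (∀ n, G.toSimpleGraph.Adj (x n) (x (n + 1))) →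
    ∑' n, ENNReal.ofReal (G.μ (x n)) = ⊤

/-- Condition (C_p) for a finite exponent `p`. -/
def CondC (p : ℝ) : Prop :=
  ∀ x, Summable (fun y => G.w x y ^ p / G.μ y ^ (p - 1))

/-- Membership of a real function on the nodes in `ℓ^p(X, μ)`. -/
def MemEll (p : ℝ) (u : X → ℝ) : Prop :=
  Summable (fun x => |u x| ^ p * G.μ x)

/-- The norm `‖u‖_p` of `ℓ^p(X, μ)`. -/
def ellNorm (p : ℝ) (u : X → ℝ) : ℝ :=
  (∑' x, |u x| ^ p * G.μ x) ^ (1 / p)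

theorem weight_rpow {p : ℝ} (hp : 1 ≤ p) (a : ℝ) (x : X) :
    (|a| * G.μ x ^ (1 / p)) ^ p = |a| ^ p * G.μ x := by
  have hp0 : p ≠ 0 := by positivity
  rw [Real.mul_rpow (abs_nonneg _) (Real.rpow_nonneg (G.μ_pos x).le _),
    ← Real.rpow_mul (G.μ_pos x).le, one_div_mul_cancel hp0, Real.rpow_one]

/-- Minkowski's inequality in `ℓ^p(X, μ)`. -/
theorem memEll_add_and_norm_le {p : ℝ} (hp : 1 ≤ p) {u v : X → ℝ}
    (hu : G.MemEll p u) (hv : G.MemEll p v) :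
    G.MemEll p (u + v) ∧ G.ellNorm p (u + v) ≤ G.ellNorm p u + G.ellNorm p v := by
  have hp0 : 0 ≤ p := by linarith
  have key := Real.Lp_add_le_tsum_of_nonneg (p := p) hp
    (f := fun x => |u x| * G.μ x ^ (1 / p)) (g := fun x => |v x| * G.μ x ^ (1 / p))
    (fun x => mul_nonneg (abs_nonneg _) (Real.rpow_nonneg (G.μ_pos x).le _))
    (fun x => mul_nonneg (abs_nonneg _) (Real.rpow_nonneg (G.μ_pos x).le _))
    (by simpa only [G.weight_rpow hp, MemEll] using hu)
    (by simpa only [G.weight_rpow hp, MemEll] using hv)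
  simp only [G.weight_rpow hp] at key
  have hle : ∀ x, |(u + v) x| ^ p * G.μ x ≤
      (|u x| * G.μ x ^ (1 / p) + |v x| * G.μ x ^ (1 / p)) ^ p := by
    intro x
    rw [← G.weight_rpow hp, ← add_mul]
    have := (G.μ_pos x).le
    gcongr
    exact abs_add_le _ _
  have hnn : ∀ x, 0 ≤ |(u + v) x| ^ p * G.μ x := fun x =>
    mul_nonneg (Real.rpow_nonneg (abs_nonneg _) _) (G.μ_pos x).le
  have hs : G.MemEll p (u + v) := Summable.of_nonneg_of_le hnn hle key.1
  refine ⟨hs, le_trans ?_ key.2⟩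
  exact Real.rpow_le_rpow (tsum_nonneg hnn) (hs.tsum_le_tsum hle key.1) (by positivity)

theorem rpow_abs_smul {p : ℝ} (c : ℝ) (u : X → ℝ) (x : X) :
    |(c • u) x| ^ p * G.μ x = |c| ^ p * (|u x| ^ p * G.μ x) := by
  rw [Pi.smul_apply, smul_eq_mul, abs_mul, Real.mul_rpow (abs_nonneg _) (abs_nonneg _)]
  ring

/-- `ℓ^p(X, μ)` as a linear space of real functions on the nodes. -/
def ellSubmodule (p : ℝ) [hp : Fact (1 ≤ p)] : Submodule ℝ (X → ℝ) where
  carrier := {u | G.MemEll p u}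
  add_mem' hu hv := (G.memEll_add_and_norm_le hp.out hu hv).1
  zero_mem' := by
    have : p ≠ 0 := by have := hp.out; positivity
    simp [MemEll, Real.zero_rpow this, summable_zero]
  smul_mem' c u hu := by
    have h : Summable fun x => |c| ^ p * (|u x| ^ p * G.μ x) := Summable.mul_left _ hu
    change Summable fun x => |(c • u) x| ^ p * G.μ x
    simpa only [rpow_abs_smul] using h

/-- The normed space `ℓ^p(X, μ)`, `1 ≤ p < ∞`. It is a type of its own, so that it carries the
norm topology and not the topology of pointwise convergence. -/
def Ell (p : ℝ) [Fact (1 ≤ p)] : Type _ := ↥(G.ellSubmodule p)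

variable (p : ℝ) [hp : Fact (1 ≤ p)]

instance : AddCommGroup (G.Ell p) := inferInstanceAs (AddCommGroup ↥(G.ellSubmodule p))

instance : Module ℝ (G.Ell p) := inferInstanceAs (Module ℝ ↥(G.ellSubmodule p))

instance : CoeFun (G.Ell p) (fun _ => X → ℝ) := ⟨fun u => u.1⟩

instance : NormedAddCommGroup (G.Ell p) :=
  AddGroupNorm.toNormedAddCommGroup
    { toFun := fun u => G.ellNorm p u
      map_zero' := by
        have h0 : p ≠ 0 := by have := hp.out; positivity
        have h1 : ((0 : G.Ell p) : X → ℝ) = 0 := rfl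
        simp [ellNorm, h1, Real.zero_rpow h0, h0]
      add_le' := fun u v => (G.memEll_add_and_norm_le hp.out u.2 v.2).2
      neg' := fun u => by
        have h1 : ((-u : G.Ell p) : X → ℝ) = -(u : X → ℝ) := rfl
        simp [ellNorm, h1]
      eq_zero_of_map_eq_zero' := fun u hu => by
        have hpos : 0 < p := by have := hp.out; positivity
        have hnn : ∀ x, 0 ≤ |u x| ^ p * G.μ x := fun x =>
          mul_nonneg (Real.rpow_nonneg (abs_nonneg _) _) (G.μ_pos x).le
        have hu' : (∑' x, |u x| ^ p * G.μ x) ^ (1 / p) = 0 := hu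
        rw [Real.rpow_eq_zero (tsum_nonneg hnn) (by positivity)] at hu'
        have hs : HasSum (fun x => |u x| ^ p * G.μ x) 0 := hu' ▸ (Summable.hasSum u.2)
        have hz := (hasSum_zero_iff_of_nonneg hnn).1 hs
        refine Subtype.ext (funext fun x => ?_)
        have hx := congrFun hz x
        have hx' : |u x| ^ p = 0 := by
          simpa [(G.μ_pos x).ne'] using hx
        rw [Real.rpow_eq_zero (abs_nonneg _) hpos.ne'] at hx'
        exact abs_eq_zero.1 hx' }

theorem Ell.norm_def (u : G.Ell p) : ‖u‖ = (∑' x, |u x| ^ p * G.μ x) ^ (1 / p) := rfl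

instance : NormedSpace ℝ (G.Ell p) where
  norm_smul_le c u := by
    have hpos : 0 < p := by have := hp.out; positivity
    have h1 : ((c • u : G.Ell p) : X → ℝ) = c • (u : X → ℝ) := rfl
    have hnn : 0 ≤ ∑' x, |u x| ^ p * G.μ x := tsum_nonneg fun x =>
      mul_nonneg (Real.rpow_nonneg (abs_nonneg _) _) (G.μ_pos x).le
    rw [Ell.norm_def, Ell.norm_def, h1]
    simp only [rpow_abs_smul]
    rw [tsum_mul_left, Real.mul_rpow (Real.rpow_nonneg (abs_nonneg _) _) hnn,
      ← Real.rpow_mul (abs_nonneg _), mul_one_div_cancel hpos.ne', Real.rpow_one,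
      Real.norm_eq_abs]

/-- The domain of the formal graph Laplacian. -/
def DomLaplacian (u : X → ℝ) : Prop :=
  ∀ x, Summable (fun y => G.w x y * |u y|)

/-- The formal graph Laplacian (meaningful on its domain). -/
def laplacian (u : X → ℝ) (x : X) : ℝ :=
  1 / G.μ x * ∑' y, G.w x y * (u x - u y) + G.κ x / G.μ x * u x

/-- The operator `𝒜 u = -f(u) + Δ u`. -/
def opA (f : ℝ → ℝ) (u : X → ℝ) (x : X) : ℝ :=
  -f (u x) + G.laplacian u x

variable {p}

/-- `u ∈ dom_p(𝒜)`, for `u ∈ ℓ^p(X, μ)`. -/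
def MemDomA (f : ℝ → ℝ) (u : G.Ell p) : Prop :=
  G.DomLaplacian u ∧ G.MemEll p (G.opA f u)

/-- An `ε`-discretization of `([0, T]; h)`: times `0 = t 0 < t 1 < ⋯ < t N ≤ T` and values
`hd 1, …, hd N` in `ℓ^p(X, μ)` (values of `t` and `hd` at other indices are irrelevant). -/
structure EpsDiscretization (T : ℝ) (h : ℝ → G.Ell p) (ε : ℝ) where
  N : ℕ
  t : ℕ → ℝ
  hd : ℕ → G.Ell p
  t_zero : t 0 = 0
  t_lt : ∀ k < N, t k < t (k + 1)
  t_le : t N ≤ T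
  step_le : ∀ k < N, t (k + 1) - t k ≤ ε
  last_le : T - t N ≤ ε
  sum_le : ∑ k ∈ Finset.range N, ∫ s in t k..t (k + 1), ‖h s - hd (k + 1)‖ ≤ ε

/-- `uk 1, …, uk N` solve the implicit Euler scheme
`(id + λ_k 𝒜) u_k = u_{k-1} + λ_k h_k`, `λ_k = t_k - t_{k-1}`, started at `uk 0 = u₀`, within
the domain of `𝒜`. -/
def IsEulerSolution (f : ℝ → ℝ) {T : ℝ} {h : ℝ → G.Ell p} {ε : ℝ}
    (D : G.EpsDiscretization T h ε) (u₀ : G.Ell p) (uk : ℕ → G.Ell p) : Prop :=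
  uk 0 = u₀ ∧ ∀ k < D.N, G.MemDomA f (uk (k + 1)) ∧
    ∀ x, uk (k + 1) x + (D.t (k + 1) - D.t k) * G.opA f (uk (k + 1)) x =
      uk k x + (D.t (k + 1) - D.t k) * D.hd (k + 1) x

/-- The piecewise constant function attached to `uk`: it is `uk 0` at time `0` and `uk k` on
`(t_{k-1}, t_k]`. -/
def interpolant {T : ℝ} {h : ℝ → G.Ell p} {ε : ℝ}
    (D : G.EpsDiscretization T h ε) (uk : ℕ → G.Ell p) (s : ℝ) : G.Ell p :=
  if s = 0 then uk 0
  else ∑ k ∈ Finset.range D.N, (Ioc (D.t k) (D.t (k + 1))).indicator (fun _ => uk (k + 1)) s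

/-- `u` (restricted to `[0, T]`, `T < ∞`) is a mild solution of `∂ₜ u + 𝒜 u = h`, `u(0) = u₀`:
it is continuous into `ℓ^p(X, μ)` and is a uniform limit of `ε`-approximate solutions. -/
def IsMildSolutionOn (f : ℝ → ℝ) (T : ℝ) (h : ℝ → G.Ell p) (u₀ : G.Ell p)
    (u : ℝ → G.Ell p) : Prop :=
  ContinuousOn u (Icc 0 T) ∧
    ∀ ε > 0, ∃ (D : G.EpsDiscretization T h ε) (uk : ℕ → G.Ell p),
      G.IsEulerSolution f D u₀ uk ∧ ∀ s ∈ Icc 0 (D.t D.N), ‖u s - G.interpolant D uk s‖ < ε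

/-- Mild solutions on `[0, T]` with `T` finite, or on `[0, ∞)` if `T = ⊤`; in the latter case,
on every compact subinterval `[0, a]`. -/
def IsMildSolution (f : ℝ → ℝ) (T : WithTop ℝ) (h : ℝ → G.Ell p) (u₀ : G.Ell p)
    (u : ℝ → G.Ell p) : Prop :=
  (∀ a : ℝ, T = a → G.IsMildSolutionOn f a h u₀ u) ∧
    (T = ⊤ → ∀ a : ℝ, 0 < a → G.IsMildSolutionOn f a h u₀ u)

end WeightedGraph

/-- The time interval `[0, T]`, read as `[0, ∞)` if `T = ⊤`. -/
def timeInterval (T : WithTop ℝ) : Set ℝ := {t | 0 ≤ t ∧ (t : WithTop ℝ) ≤ T}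

/-- Condition (F1): continuous, monotone decreasing, vanishing at `0`. -/
def CondF1 (f : ℝ → ℝ) : Prop := Continuous f ∧ Antitone f ∧ f 0 = 0

/-- Condition (F2): uniformly Lipschitz with some constant `L > 0`, vanishing at `0`. -/
def CondF2 (f : ℝ → ℝ) : Prop := (∃ L : NNReal, 0 < L ∧ LipschitzWith L f) ∧ f 0 = 0

end

noncomputable section

/-! ### Positive parts in `ℓ^p(X, μ)` -/

namespace WeightedGraph

variable {X : Type*} {G : WeightedGraph X} {p : ℝ} [hp : Fact (1 ≤ p)]

namespace Ell

/-! The size of the positive part, `posNorm (u - v)`, vanishes exactly when `u ≤ v`. The theorem is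
a stability estimate for this one-sided quantity, in three layers.

Accretivity (`posNorm_sub_le_of_condIP`). The only property of `f` needed is `f a - f b ≤ L (a - b)`
for `b ≤ a`. Under it the positive part of `u - v` is a subsolution of a linear resolvent equation
on the graph. Jensen's inequality makes its `p`-th power a subsolution as well, so an `ℓ^1`
statement suffices for all `p`. That statement is `tsum_le_of_subsolution`. A summable subsolution
cannot exceed the minimal solution: otherwise the excess would increase strictly along an infinite
path, which (IP) forbids.

Discretization. Approximate solutions for `u` and `v` live on unrelated time grids. Accretivity with
step `a b / (a + b)` bounds their differences by a two-index recursion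
(`posNorm_sub_le_of_euler_steps`), which is compared with an explicit supersolution
(`le_of_double_recursion`, `supersolution_step`). This is the doubling of the time variable of
Crandall–Liggett and Kobayashi type.

Limit. With a continuous approximation of `h` serving as common reference, `u₀ ≤ v₀` and `h ≤ g`
make the data errors `O(η)` (`posNorm_sub_le_mul`), and `η → 0` gives the result. -/

theorem exponent_pos (p : ℝ) [hp : Fact (1 ≤ p)] : 0 < p := lt_of_lt_of_le one_pos hp.out

theorem coe_add (u v : G.Ell p) (x : X) : (u + v) x = u x + v x := rfl

theorem coe_sub (u v : G.Ell p) (x : X) : (u - v) x = u x - v x := rfl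

theorem coe_smul (c : ℝ) (u : G.Ell p) (x : X) : (c • u) x = c * u x := rfl

theorem ext {u v : G.Ell p} (h : ∀ x, u x = v x) : u = v := Subtype.ext (funext h)

theorem memEll_of_abs_le {u : X → ℝ} {v : G.Ell p} (h : ∀ x, |u x| ≤ |v x|) :
    G.MemEll p u :=
  Summable.of_nonneg_of_le
    (fun x => mul_nonneg (Real.rpow_nonneg (abs_nonneg _) _) (G.μ_pos x).le)
    (fun x => mul_le_mul_of_nonneg_right
      (Real.rpow_le_rpow (abs_nonneg _) (h x) (exponent_pos p).le) (G.μ_pos x).le) v.2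

theorem norm_le_of_abs_le {u v : G.Ell p} (h : ∀ x, |u x| ≤ |v x|) : ‖u‖ ≤ ‖v‖ := by
  rw [norm_def, norm_def]
  refine Real.rpow_le_rpow (tsum_nonneg fun x =>
    mul_nonneg (Real.rpow_nonneg (abs_nonneg _) _) (G.μ_pos x).le) ?_
    (one_div_nonneg.2 (exponent_pos p).le)
  exact Summable.tsum_le_tsum (fun x => mul_le_mul_of_nonneg_right
      (Real.rpow_le_rpow (abs_nonneg _) (h x) (exponent_pos p).le) (G.μ_pos x).le) u.2 v.2

/-- The positive part of an element of `ℓ^p(X, μ)`. -/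
def pos (u : G.Ell p) : G.Ell p :=
  ⟨fun x => max (u x) 0, memEll_of_abs_le (v := u) fun x => by
    rw [abs_of_nonneg (le_max_right _ _)]
    exact max_le (le_abs_self _) (abs_nonneg _)⟩

theorem pos_apply (u : G.Ell p) (x : X) : u.pos x = max (u x) 0 := rfl

/-- The norm of the positive part. -/
def posNorm (u : G.Ell p) : ℝ := ‖u.pos‖

theorem posNorm_nonneg (u : G.Ell p) : 0 ≤ u.posNorm := norm_nonneg _

theorem posNorm_le_norm (u : G.Ell p) : u.posNorm ≤ ‖u‖ :=
  norm_le_of_abs_le fun x => by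
    rw [pos_apply, abs_of_nonneg (le_max_right _ _)]
    exact max_le (le_abs_self _) (abs_nonneg _)

theorem posNorm_add_le (u v : G.Ell p) : (u + v).posNorm ≤ u.posNorm + v.posNorm := by
  refine le_trans (norm_le_of_abs_le fun x => ?_) (norm_add_le u.pos v.pos)
  rw [coe_add, pos_apply, pos_apply, pos_apply, coe_add, abs_of_nonneg (le_max_right _ _),
    abs_of_nonneg (add_nonneg (le_max_right _ _) (le_max_right _ _))]
  exact max_le (add_le_add (le_max_left _ _) (le_max_left _ _))
    (add_nonneg (le_max_right _ _) (le_max_right _ _))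

theorem posNorm_smul {c : ℝ} (hc : 0 ≤ c) (u : G.Ell p) :
    (c • u).posNorm = c * u.posNorm := by
  have : (c • u).pos = c • u.pos := ext fun x => by
    rw [coe_smul, pos_apply, pos_apply, coe_smul, mul_max_of_nonneg _ _ hc, mul_zero]
  rw [posNorm, this, norm_smul, Real.norm_of_nonneg hc, posNorm]

theorem posNorm_le_add_norm_sub (u v : G.Ell p) : u.posNorm ≤ v.posNorm + ‖u - v‖ := by
  have h := posNorm_add_le v (u - v)
  rw [add_sub_cancel] at h
  exact h.trans (add_le_add_right (posNorm_le_norm _) _)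

theorem posNorm_eq_zero_iff {u : G.Ell p} : u.posNorm = 0 ↔ ∀ x, u x ≤ 0 := by
  rw [posNorm, norm_eq_zero]
  constructor
  · intro h x
    have : u.pos x = 0 := by rw [h]; rfl
    rw [pos_apply] at this
    exact max_eq_right_iff.1 this
  · intro h
    exact ext fun x => by rw [pos_apply, max_eq_right (h x)]; rfl

/-- `ENNReal.ofReal` sends negative values to `0`, so it takes the positive part by itself. This is
the bridge to the `ℝ≥0∞`-valued maximum principle. -/
theorem tsum_ofReal_rpow (u : G.Ell p) :
    ∑' x, ENNReal.ofReal (G.μ x) * ENNReal.ofReal (u x) ^ p =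
      ENNReal.ofReal (u.posNorm ^ p) := by
  have h0 := exponent_pos p
  have hnn : ∀ x, 0 ≤ |u.pos x| ^ p * G.μ x := fun x =>
    mul_nonneg (Real.rpow_nonneg (abs_nonneg _) _) (G.μ_pos x).le
  rw [posNorm, norm_def, ← Real.rpow_mul (tsum_nonneg hnn), one_div_mul_cancel h0.ne',
    Real.rpow_one, ENNReal.ofReal_tsum_of_nonneg hnn u.pos.2]
  refine tsum_congr fun x => ?_
  rw [ENNReal.ofReal_mul (Real.rpow_nonneg (abs_nonneg _) _), mul_comm, pos_apply,
    abs_of_nonneg (le_max_right _ _),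
    ← ENNReal.ofReal_rpow_of_nonneg (le_max_right _ _) h0.le]
  congr 2
  rcases le_total (u x) 0 with h | h
  · rw [max_eq_right h, ENNReal.ofReal_zero, ENNReal.ofReal_of_nonpos h]
  · rw [max_eq_left h]

end Ell

end WeightedGraph

/-! ### A maximum principle on graphs satisfying (IP) -/

open scoped ENNReal

namespace WeightedGraph

variable {X : Type*}

/-- Strict growth of `d` along the walk excludes repeated nodes, which is what turns it into a path
in the sense of (IP). -/
theorem exists_increasing_path {α : Type*} [Preorder α] {r : X → X → Prop} {d : X → α}
    {P : X → Prop} {x₀ : X} (h₀ : P x₀) (step : ∀ x, P x → ∃ y, P y ∧ r x y ∧ d x < d y) :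
    ∃ x : ℕ → X, x 0 = x₀ ∧ (∀ n, r (x n) (x (n + 1))) ∧ StrictMono (d ∘ x) := by
  choose! next hP hr hd using step
  let x : ℕ → X := fun n => next^[n] x₀
  have hx : ∀ n, P (x n) := by
    intro n
    induction n with
    | zero => exact h₀
    | succ n ih =>
      simp only [x, Function.iterate_succ_apply']
      exact hP _ ih
  have hsucc : ∀ n, x (n + 1) = next (x n) := fun n => Function.iterate_succ_apply' _ _ _
  refine ⟨x, rfl, fun n => ?_, strictMono_nat_of_lt_succ fun n => ?_⟩
  · rw [hsucc]; exact hr _ (hx n)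
  · simp only [Function.comp, hsucc]; exact hd _ (hx n)

/-- One step of the Jacobi iteration for `(1 + Δ) z = 0`, with edge weights `b` and node
measure `μ`. -/
def jacobiStep (μ : X → ℝ≥0∞) (b : X → X → ℝ≥0∞) (f : X → ℝ≥0∞) (x : X) : ℝ≥0∞ :=
  (∑' y, b x y * f y) / (μ x + ∑' y, b x y)

variable {μ : X → ℝ≥0∞} {b : X → X → ℝ≥0∞}

theorem mul_jacobiStep (hμ0 : ∀ x, μ x ≠ 0) (hμ : ∀ x, μ x ≠ ⊤) (hb : ∀ x, ∑' y, b x y ≠ ⊤)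
    (f : X → ℝ≥0∞) (x : X) :
    (μ x + ∑' y, b x y) * jacobiStep μ b f x = ∑' y, b x y * f y :=
  ENNReal.mul_div_cancel (by simp [hμ0]) (ENNReal.add_ne_top.2 ⟨hμ x, hb x⟩)

/-- Mass balance: by symmetry of `b`, a Jacobi step loses precisely the `μ`-mass of `f`. Summed over
the iterates this telescopes. -/
theorem tsum_mul_jacobiStep (hμ0 : ∀ x, μ x ≠ 0) (hμ : ∀ x, μ x ≠ ⊤)
    (hb : ∀ x, ∑' y, b x y ≠ ⊤) (hsymm : ∀ x y, b x y = b y x) (f : X → ℝ≥0∞) :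
    ∑' x, μ x * f x + ∑' x, (μ x + ∑' y, b x y) * jacobiStep μ b f x =
      ∑' x, (μ x + ∑' y, b x y) * f x := by
  simp_rw [mul_jacobiStep hμ0 hμ hb, add_mul, ENNReal.tsum_add]
  congr 1
  rw [ENNReal.tsum_comm]
  refine tsum_congr fun x => ?_
  rw [← ENNReal.tsum_mul_right]
  exact tsum_congr fun y => by rw [hsymm]

/-- The minimal nonnegative solution of `(1 + Δ) z = g`, `Δ` being the Laplacian with edge
weights `b`, has at most the mass of `g`. -/
theorem exists_solution_tsum_le (hμ0 : ∀ x, μ x ≠ 0) (hμ : ∀ x, μ x ≠ ⊤)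
    (hb : ∀ x, ∑' y, b x y ≠ ⊤) (hsymm : ∀ x y, b x y = b y x) (g : X → ℝ≥0∞) :
    ∃ z : X → ℝ≥0∞, (∀ x, (μ x + ∑' y, b x y) * z x = μ x * g x + ∑' y, b x y * z y) ∧
      ∑' x, μ x * z x ≤ ∑' x, μ x * g x := by
  have hm0 : ∀ x, μ x + ∑' y, b x y ≠ 0 := fun x => by simp [hμ0]
  have hm : ∀ x, μ x + ∑' y, b x y ≠ ⊤ := fun x => ENNReal.add_ne_top.2 ⟨hμ x, hb x⟩
  let g' : X → ℝ≥0∞ := fun x => μ x * g x / (μ x + ∑' y, b x y)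
  have hg' : ∀ x, (μ x + ∑' y, b x y) * g' x = μ x * g x := fun x =>
    ENNReal.mul_div_cancel (hm0 x) (hm x)
  -- The solution is the Neumann series `∑ q k`; working in `ℝ≥0∞` makes convergence and exchange of
  -- sums automatic.
  let q : ℕ → X → ℝ≥0∞ := fun k => (jacobiStep μ b)^[k] g'
  have hq : ∀ k, q (k + 1) = jacobiStep μ b (q k) := fun k =>
    Function.iterate_succ_apply' _ _ _
  refine ⟨fun x => ∑' k, q k x, fun x => ?_, ?_⟩
  · change _ * ∑' k, q k x = _ + ∑' y, b x y * ∑' k, q k y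
    rw [tsum_eq_zero_add' ENNReal.summable, mul_add, ← ENNReal.tsum_mul_left]
    congr 1
    · exact hg' x
    · simp_rw [hq, mul_jacobiStep hμ0 hμ hb, ← ENNReal.tsum_mul_left]
      exact ENNReal.tsum_comm
  · have hpartial : ∀ n, ∑ k ∈ Finset.range n, ∑' x, μ x * q k x
        + ∑' x, (μ x + ∑' y, b x y) * q n x = ∑' x, μ x * g x := by
      intro n
      induction n with
      | zero =>
        simp only [Finset.range_zero, Finset.sum_empty, zero_add]
        exact tsum_congr hg'
      | succ n ih =>
        rw [Finset.sum_range_succ, add_assoc, hq,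
          tsum_mul_jacobiStep hμ0 hμ hb hsymm, ih]
    simp_rw [← ENNReal.tsum_mul_left]
    rw [ENNReal.tsum_comm, ENNReal.tsum_eq_iSup_nat]
    exact iSup_le fun n => (hpartial n).le.trans' le_self_add

/-- A maximum principle: integrable subsolutions of `(1 + Δ) z = g` have at most the mass of `g`
if all infinite paths have infinite measure. -/
theorem tsum_le_of_subsolution (hμ0 : ∀ x, μ x ≠ 0) (hμ : ∀ x, μ x ≠ ⊤)
    (hb : ∀ x, ∑' y, b x y ≠ ⊤) (hsymm : ∀ x y, b x y = b y x)
    (hpath : ∀ x : ℕ → X, Function.Injective x → (∀ n, b (x n) (x (n + 1)) ≠ 0) →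
      ∑' n, μ (x n) = ⊤)
    {g W : X → ℝ≥0∞} (hW : ∑' x, μ x * W x ≠ ⊤)
    (hsub : ∀ x, (μ x + ∑' y, b x y) * W x ≤ μ x * g x + ∑' y, b x y * W y) :
    ∑' x, μ x * W x ≤ ∑' x, μ x * g x := by
  by_cases hg : ∑' x, μ x * g x = ⊤
  · rw [hg]; exact le_top
  obtain ⟨Z, hZ, hZg⟩ := exists_solution_tsum_le hμ0 hμ hb hsymm g
  have hfin : ∀ {f : X → ℝ≥0∞}, ∑' x, μ x * f x ≠ ⊤ → ∀ x, f x ≠ ⊤ := by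
    intro f hf x hx
    have := ENNReal.ne_top_of_tsum_ne_top hf x
    rw [hx, ENNReal.mul_top (hμ0 x)] at this
    exact this rfl
  have hWx := hfin hW
  have hZx := hfin (ne_top_of_le_ne_top hg hZg)
  have hgx := hfin hg
  have hm0 : ∀ x, μ x + ∑' y, b x y ≠ 0 := fun x => by simp [hμ0]
  have hm : ∀ x, μ x + ∑' y, b x y ≠ ⊤ := fun x => ENNReal.add_ne_top.2 ⟨hμ x, hb x⟩
  suffices h : ∀ x, W x ≤ Z x from
    (ENNReal.tsum_le_tsum fun x => mul_le_mul_right (h x) _).trans hZg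
  by_contra! hcon
  obtain ⟨x₀, hx₀⟩ := hcon
  -- If no neighbour had a larger excess than `c = W x - Z x`, subtracting the equation of `Z` from
  -- the inequality of `W` would leave `(μ x + ∑ b) c ≤ (∑ b) c`, impossible since `μ x > 0` and `0
  -- < c < ∞`.
  have step : ∀ x, Z x < W x → ∃ y, Z y < W y ∧ b x y ≠ 0 ∧ W x - Z x < W y - Z y := by
    intro x hx
    by_contra! hno
    have hc : W x = Z x + (W x - Z x) := (add_tsub_cancel_of_le hx.le).symm
    have hc0 : W x - Z x ≠ 0 := (tsub_pos_of_lt hx).ne'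
    have hct : W x - Z x ≠ ⊤ := ENNReal.sub_ne_top (hWx x)
    set c := W x - Z x
    have hy : ∀ y, b x y * W y ≤ b x y * Z y + b x y * c := by
      intro y
      by_cases hb0 : b x y = 0
      · simp [hb0]
      rw [← mul_add]
      refine mul_le_mul_right ?_ _
      rcases lt_or_ge (Z y) (W y) with h | h
      · exact tsub_le_iff_left.1 (hno y h hb0)
      · exact h.trans le_self_add
    have h1 := (hsub x).trans (add_le_add_right (ENNReal.tsum_le_tsum hy) _)
    rw [ENNReal.tsum_add, ← add_assoc, ← hZ x, hc, mul_add, ENNReal.tsum_mul_right] at h1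
    have h2 := (ENNReal.add_le_add_iff_left (ENNReal.mul_ne_top (hm x) (hZx x))).1 h1
    have h3 := (ENNReal.mul_le_mul_iff_left hc0 hct).1 h2
    exact absurd h3 (not_le.2 (by
      rw [add_comm]
      exact ENNReal.lt_add_right (hb x) (hμ0 x)))
  obtain ⟨x, hx0, hadj, hmono⟩ := exists_increasing_path
    (r := fun x y => b x y ≠ 0) (d := fun x => W x - Z x) (P := fun x => Z x < W x) hx₀ step
  have hinj : Function.Injective x := hmono.injective.of_comp
  have hc0 : W x₀ - Z x₀ ≠ 0 := (tsub_pos_of_lt hx₀).ne'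
  -- Along the path `W` stays above the initial excess, so infinite measure of the path contradicts
  -- summability of `W`.
  refine hW (top_le_iff.1 ?_)
  calc ⊤ = (∑' n, μ (x n)) * (W x₀ - Z x₀) := by
        rw [hpath x hinj hadj, ENNReal.top_mul hc0]
    _ = ∑' n, μ (x n) * (W x₀ - Z x₀) := ENNReal.tsum_mul_right.symm
    _ ≤ ∑' n, μ (x n) * W (x n) := ENNReal.tsum_le_tsum fun n => by
        refine mul_le_mul_right ?_ _
        have := hmono.monotone (Nat.zero_le n)
        simp only [Function.comp, hx0] at this
        exact this.trans tsub_le_self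
    _ ≤ ∑' x, μ x * W x := ENNReal.tsum_comp_le_tsum_of_injective hinj _

/-- Jensen's inequality for the power `p` and a countable weighted mean. -/
theorem mul_rpow_le_of_mul_le_tsum {ι : Type*} {p : ℝ} (hp : 1 ≤ p) {a f : ι → ℝ≥0∞} {z : ℝ≥0∞}
    (ha0 : ∑' i, a i ≠ 0) (ha : ∑' i, a i ≠ ⊤) (h : (∑' i, a i) * z ≤ ∑' i, a i * f i) :
    (∑' i, a i) * z ^ p ≤ ∑' i, a i * f i ^ p := by
  have hp0 : 0 < p := by linarith
  set A := ∑' i, a i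
  -- Weighted Hölder on finite subsets, then the supremum; below, the `p`-th power is taken and `A ^
  -- (p - 1)` cancelled.
  have h1 : ∑' i, a i * f i ≤ A ^ (1 - p⁻¹) * (∑' i, a i * f i ^ p) ^ p⁻¹ := by
    rw [ENNReal.tsum_eq_iSup_sum]
    refine iSup_le fun s => (ENNReal.inner_le_weight_mul_Lp_of_nonneg s hp a f).trans ?_
    have : 0 ≤ 1 - p⁻¹ := sub_nonneg.2 (inv_le_one_of_one_le₀ hp)
    gcongr
    · exact ENNReal.sum_le_tsum s
    · exact ENNReal.sum_le_tsum s
  have h2 := ENNReal.rpow_le_rpow (h.trans h1) hp0.le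
  rw [ENNReal.mul_rpow_of_nonneg _ _ hp0.le, ENNReal.mul_rpow_of_nonneg _ _ hp0.le,
    ← ENNReal.rpow_mul, ← ENNReal.rpow_mul, inv_mul_cancel₀ hp0.ne', ENNReal.rpow_one,
    sub_mul, inv_mul_cancel₀ hp0.ne', one_mul] at h2
  have h3 : A ^ p = A ^ (p - 1) * A := by
    conv_rhs => rw [← ENNReal.rpow_one A, ← ENNReal.rpow_mul, one_mul]
    rw [← ENNReal.rpow_add _ _ ha0 ha]; congr 1; ring
  rw [h3, mul_assoc] at h2
  refine (ENNReal.mul_le_mul_iff_right ?_ ?_).1 h2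
  · exact (ENNReal.rpow_pos (pos_iff_ne_zero.2 ha0) ha).ne'
  · exact ENNReal.rpow_ne_top_of_nonneg (by linarith) ha

/-- The right-hand side is a weighted sum over `X` and one extra point, `none : Option X`, with
weight `m` and value `g`. Jensen's inequality applies to it. -/
theorem mul_rpow_le_of_subsolution {p : ℝ} (hp : 1 ≤ p) {m : ℝ≥0∞} {b : X → ℝ≥0∞} (hm0 : m ≠ 0)
    (hm : m ≠ ⊤) (hb : ∑' y, b y ≠ ⊤) {g z : ℝ≥0∞} {f : X → ℝ≥0∞}
    (h : (m + ∑' y, b y) * z ≤ m * g + ∑' y, b y * f y) :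
    (m + ∑' y, b y) * z ^ p ≤ m * g ^ p + ∑' y, b y * f y ^ p := by
  have hopt : ∀ k : Option X → ℝ≥0∞, ∑' i, k i = k none + ∑' y, k (some y) := fun k => by
    rw [← (Equiv.optionEquivSumPUnit.{0} X).symm.tsum_eq, ENNReal.summable.tsum_sum
      ENNReal.summable]
    simp [add_comm]
  have key := mul_rpow_le_of_mul_le_tsum (p := p) (z := z) hp
    (a := fun i : Option X => i.elim m b) (f := fun i : Option X => i.elim g f)
  simp only [hopt, Option.elim] at key
  exact key (by simp [hm0]) (ENNReal.add_ne_top.2 ⟨hm, hb⟩) h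

end WeightedGraph

/-! ### T-accretivity of the operator -/

namespace WeightedGraph

variable {X : Type*} {G : WeightedGraph X} {p : ℝ} [hp : Fact (1 ≤ p)]

theorem DomLaplacian.summable {u : X → ℝ} (hu : G.DomLaplacian u) (x : X) :
    Summable fun y => G.w x y * u y :=
  Summable.of_abs (by
    simpa only [abs_mul, abs_of_nonneg (G.w_nonneg _ _)] using hu x)

theorem DomLaplacian.tsum_eq {u : X → ℝ} (hu : G.DomLaplacian u) (x : X) :
    ∑' y, G.w x y * (u x - u y) = (∑' y, G.w x y) * u x - ∑' y, G.w x y * u y := by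
  simp_rw [mul_sub]
  rw [((G.w_summable x).mul_right (u x)).tsum_sub (hu.summable x), tsum_mul_right]

theorem DomLaplacian.summable_max_sub {u v : X → ℝ} (hu : G.DomLaplacian u)
    (hv : G.DomLaplacian v) (x : X) : Summable fun y => G.w x y * max (u y - v y) 0 := by
  refine Summable.of_nonneg_of_le
    (fun y => mul_nonneg (G.w_nonneg x y) (le_max_right _ _)) (fun y => ?_)
    ((hu x).add (hv x))
  rw [← mul_add]
  refine mul_le_mul_of_nonneg_left (max_le ?_ (by positivity)) (G.w_nonneg x y)
  linarith [le_abs_self (u y), neg_abs_le (v y)]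

/-- The positive part of a difference is a subsolution of a linear equation. -/
theorem subsolution_max_sub {f : ℝ → ℝ} {L : ℝ} (hf : ∀ a b, b ≤ a → f a - f b ≤ L * (a - b))
    {u v : X → ℝ} (hu : G.DomLaplacian u) (hv : G.DomLaplacian v) {θ : ℝ} (hθ : 0 < θ)
    (hθL : θ * L < 1) (x : X) :
    (G.μ x + θ / (1 - θ * L) * ∑' y, G.w x y) * max (u x - v x) 0 ≤
      G.μ x * max ((u x - v x + θ * (G.opA f u x - G.opA f v x)) / (1 - θ * L)) 0 +
        θ / (1 - θ * L) * ∑' y, G.w x y * max (u y - v y) 0 := by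
  have hβ : 0 < 1 - θ * L := by linarith
  have hμ := G.μ_pos x
  have hSnn : 0 ≤ ∑' y, G.w x y * max (u y - v y) 0 :=
    tsum_nonneg fun y => mul_nonneg (G.w_nonneg x y) (le_max_right _ _)
  rcases le_or_gt (u x) (v x) with h | h
  -- Where `u x ≤ v x` the left side vanishes. Elsewhere the killing term has a good sign, the
  -- `f`-term costs the factor `1 - θ L`, and neighbouring differences are at most their positive
  -- parts.
  · rw [max_eq_right (sub_nonpos.2 h), mul_zero]
    have := le_max_right ((u x - v x + θ * (G.opA f u x - G.opA f v x)) / (1 - θ * L)) 0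
    positivity
  have hS : Summable fun y => G.w x y * max (u y - v y) 0 := hu.summable_max_sub hv x
  have hle : (∑' y, G.w x y * u y) - ∑' y, G.w x y * v y
      ≤ ∑' y, G.w x y * max (u y - v y) 0 := by
    rw [← (hu.summable x).tsum_sub (hv.summable x)]
    refine Summable.tsum_le_tsum (fun y => ?_) ((hu.summable x).sub (hv.summable x)) hS
    rw [← mul_sub]
    exact mul_le_mul_of_nonneg_left (le_max_left _ _) (G.w_nonneg x y)
  have hF : G.μ x * (u x - v x + θ * (G.opA f u x - G.opA f v x)) =
      G.μ x * (u x - v x) - θ * G.μ x * (f (u x) - f (v x)) +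
        θ * ((∑' y, G.w x y) * (u x - v x) -
          ((∑' y, G.w x y * u y) - ∑' y, G.w x y * v y)) + θ * G.κ x * (u x - v x) := by
    rw [opA, opA, laplacian, laplacian, hu.tsum_eq, hv.tsum_eq]
    field_simp
    ring
  have h1 := mul_le_mul_of_nonneg_left (hf _ _ h.le) (mul_pos hθ hμ).le
  have h2 := mul_nonneg (mul_nonneg hθ.le (G.κ_nonneg x)) (sub_pos.2 h).le
  have h3 := mul_le_mul_of_nonneg_left hle hθ.le
  have h4 : ((1 - θ * L) * G.μ x + θ * ∑' y, G.w x y) * (u x - v x) ≤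
      G.μ x * (u x - v x + θ * (G.opA f u x - G.opA f v x)) +
        θ * ∑' y, G.w x y * max (u y - v y) 0 := by
    rw [hF]; linarith
  rw [max_eq_left (sub_pos.2 h).le]
  calc _ = ((1 - θ * L) * G.μ x + θ * ∑' y, G.w x y) * (u x - v x) / (1 - θ * L) := by
        field_simp
    _ ≤ (G.μ x * (u x - v x + θ * (G.opA f u x - G.opA f v x)) +
        θ * ∑' y, G.w x y * max (u y - v y) 0) / (1 - θ * L) := by gcongr
    _ = G.μ x * ((u x - v x + θ * (G.opA f u x - G.opA f v x)) / (1 - θ * L)) +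
        θ / (1 - θ * L) * ∑' y, G.w x y * max (u y - v y) 0 := by ring
    _ ≤ _ := by
        gcongr
        exact le_max_left _ _

/-- T-accretivity of `𝒜 + L` in `ℓ^p(X, μ)`. -/
theorem posNorm_sub_le_of_condIP (hIP : G.CondIP) {f : ℝ → ℝ} {L : ℝ}
    (hf : ∀ a b, b ≤ a → f a - f b ≤ L * (a - b)) {u v : G.Ell p} (hu : G.DomLaplacian u)
    (hv : G.DomLaplacian v) {θ : ℝ} (hθ : 0 < θ) (hθL : θ * L < 1) {F : G.Ell p}
    (hF : ∀ x, F x = u x - v x + θ * (G.opA f u x - G.opA f v x)) :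
    (1 - θ * L) * (u - v).posNorm ≤ F.posNorm := by
  have hβ : 0 < 1 - θ * L := by linarith
  have hc : 0 < θ / (1 - θ * L) := div_pos hθ hβ
  have hp0 := Ell.exponent_pos p
  set c := θ / (1 - θ * L) with hcdef
  let b : X → X → ENNReal := fun x y => ENNReal.ofReal (c * G.w x y)
  have hbsum : ∀ x, ∑' y, b x y = ENNReal.ofReal (c * ∑' y, G.w x y) := fun x => by
    rw [← tsum_mul_left, ENNReal.ofReal_tsum_of_nonneg
      (fun y => mul_nonneg hc.le (G.w_nonneg x y)) ((G.w_summable x).mul_left c)]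
  have hμ0 : ∀ x, ENNReal.ofReal (G.μ x) ≠ 0 := fun x => by simp [G.μ_pos x]
  have hμt : ∀ x, ENNReal.ofReal (G.μ x) ≠ ⊤ := fun x => ENNReal.ofReal_ne_top
  have hbt : ∀ x, ∑' y, b x y ≠ ⊤ := fun x => by rw [hbsum]; exact ENNReal.ofReal_ne_top
  have hsub : ∀ x, (ENNReal.ofReal (G.μ x) + ∑' y, b x y) * ENNReal.ofReal ((u - v) x) ≤
      ENNReal.ofReal (G.μ x) * ENNReal.ofReal (((1 - θ * L)⁻¹ • F) x) +
        ∑' y, b x y * ENNReal.ofReal ((u - v) y) := by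
    intro x
    have hmax : ∀ a : ℝ, ENNReal.ofReal a = ENNReal.ofReal (max a 0) := fun a => by simp
    have hd : 0 ≤ ∑' y, G.w x y := tsum_nonneg (G.w_nonneg x)
    have hS : Summable fun y => G.w x y * max (u y - v y) 0 := hu.summable_max_sub hv x
    have hsum : ∑' y, b x y * ENNReal.ofReal ((u - v) y) =
        ENNReal.ofReal (c * ∑' y, G.w x y * max (u y - v y) 0) := by
      rw [← tsum_mul_left, ENNReal.ofReal_tsum_of_nonneg (fun y =>
        mul_nonneg hc.le (mul_nonneg (G.w_nonneg x y) (le_max_right _ _))) (hS.mul_left c)]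
      refine tsum_congr fun y => ?_
      rw [← mul_assoc, ENNReal.ofReal_mul (mul_nonneg hc.le (G.w_nonneg x y)), ← hmax,
        Ell.coe_sub]
    have hSnn : 0 ≤ ∑' y, G.w x y * max (u y - v y) 0 :=
      tsum_nonneg fun y => mul_nonneg (G.w_nonneg x y) (le_max_right _ _)
    have hμ := (G.μ_pos x).le
    rw [hsum, hbsum, hmax ((u - v) x), hmax (((1 - θ * L)⁻¹ • F) x), Ell.coe_sub,
      Ell.coe_smul, hF, ← ENNReal.ofReal_add hμ (by positivity),
      ← ENNReal.ofReal_mul (by positivity), ← ENNReal.ofReal_mul hμ,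
      ← ENNReal.ofReal_add (mul_nonneg hμ (le_max_right _ _)) (by positivity)]
    refine ENNReal.ofReal_le_ofReal ?_
    have := subsolution_max_sub hf hu hv hθ hθL x
    rwa [div_eq_inv_mul (_ + _)] at this
  -- The maximum principle is applied to `p`-th powers, whose total masses are `posNorm ^ p`.
  have key := tsum_le_of_subsolution hμ0 hμt hbt (fun x y => by simp only [b, G.w_symm x y])
    (fun x hx hadj => hIP x hx fun n h => hadj n (by simp [b, h]))
    (W := fun x => ENNReal.ofReal ((u - v) x) ^ p)
    (by rw [Ell.tsum_ofReal_rpow]; exact ENNReal.ofReal_ne_top)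
    (fun x => mul_rpow_le_of_subsolution hp.out (hμ0 x) (hμt x) (hbt x) (hsub x))
  rw [Ell.tsum_ofReal_rpow, Ell.tsum_ofReal_rpow, ENNReal.ofReal_le_ofReal_iff
    (Real.rpow_nonneg (Ell.posNorm_nonneg _) _), Real.rpow_le_rpow_iff (Ell.posNorm_nonneg _)
    (Ell.posNorm_nonneg _) hp0, Ell.posNorm_smul (inv_nonneg.2 hβ.le)] at key
  rwa [← le_inv_mul_iff₀ hβ]

end WeightedGraph

/-! ### The two-index recursion -/

namespace WeightedGraph

/-- Comparison for the two-index recursion of two implicit Euler schemes with step sizes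
`a` and `b`. -/
theorem le_of_double_recursion {N M : ℕ} {a b : ℕ → ℝ} {L : ℝ} {ψ Φ H : ℕ → ℕ → ℝ}
    (ha : ∀ i < N, 0 < a i) (hb : ∀ j < M, 0 < b j)
    (hpos : ∀ i < N, ∀ j < M, 0 < a i + b j - a i * b j * L)
    (hi : ∀ i ≤ N, ψ i 0 ≤ Φ i 0) (hj : ∀ j ≤ M, ψ 0 j ≤ Φ 0 j)
    (hψ : ∀ i < N, ∀ j < M, (a i + b j - a i * b j * L) * ψ (i + 1) (j + 1) ≤
      b j * ψ i (j + 1) + a i * ψ (i + 1) j + a i * b j * H i j)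
    (hΦ : ∀ i < N, ∀ j < M, b j * Φ i (j + 1) + a i * Φ (i + 1) j + a i * b j * H i j ≤
      (a i + b j - a i * b j * L) * Φ (i + 1) (j + 1)) :
    ∀ i ≤ N, ∀ j ≤ M, ψ i j ≤ Φ i j := by
  intro i
  induction i with
  | zero => exact fun _ => hj
  | succ i ihi =>
    intro hiN j
    induction j with
    | zero => exact fun _ => hi _ hiN
    | succ j ihj =>
      intro hjM
      refine le_of_mul_le_mul_left ?_ (hpos i hiN j hjM)
      refine (hψ i hiN j hjM).trans (le_trans ?_ (hΦ i hiN j hjM))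
      have h1 := mul_le_mul_of_nonneg_left (ihi (by omega) (j + 1) hjM) (hb j hjM).le
      have h2 := mul_le_mul_of_nonneg_left (ihj (by omega)) (ha i hiN).le
      linarith

/-- The function `exp (2 (L + 1) t) (η + M (t - s)² + 2 e(t) + 2 d(s))` is a supersolution of
the two-index recursion, if the steps are small. -/
theorem supersolution_step {L M T η ε t r a b ρ σ e d : ℝ} (hL : 0 ≤ L) (hM : 0 ≤ M)
    (ha : 0 < a) (hb : 0 < b) (haε : a ≤ ε) (hbε : b ≤ ε) (ht : 0 ≤ t) (hr : |r| ≤ T)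
    (hη : 0 ≤ η) (hρ : 0 ≤ ρ) (hσ : 0 ≤ σ) (he : 0 ≤ e) (hd : 0 ≤ d)
    (hε : 2 * (L + 1) * ε ≤ 1) (hεη : 2 * M * ε * (1 + (L + 1) * T) ≤ η / 2) :
    b * (Real.exp (2 * (L + 1) * t) *
        (η + M * (r - a) ^ 2 + 2 * e + 2 * (d + b * σ))) +
      a * (Real.exp (2 * (L + 1) * (t + a)) *
        (η + M * (r + b) ^ 2 + 2 * (e + a * ρ) + 2 * d)) +
      a * b * (ρ + σ + η / 2 + M * r ^ 2) ≤
    (a + b - a * b * L) * (Real.exp (2 * (L + 1) * (t + a)) *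
        (η + M * r ^ 2 + 2 * (e + a * ρ) + 2 * (d + b * σ))) := by
  set E := Real.exp (2 * (L + 1) * (t + a)) with hE
  have hE1 : 1 ≤ E := Real.one_le_exp (by positivity)
  have hKa : (L + 1) * a ≤ 1 / 2 := by nlinarith
  -- With `K = L + 1`: `exp (-2Ka) ≤ 1 / (1 + 2Ka) ≤ 1 - Ka`, the last step because `Ka ≤ 1/2`.
  -- Hence the rate `2 (L + 1)`.
  have hE' : Real.exp (2 * (L + 1) * t) ≤ (1 - (L + 1) * a) * E := by
    have h1 : Real.exp (2 * (L + 1) * t) = Real.exp (-(2 * (L + 1) * a)) * E := by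
      rw [hE, ← Real.exp_add]; ring_nf
    rw [h1]
    refine mul_le_mul_of_nonneg_right ?_ (by linarith)
    have h2 : 1 + 2 * (L + 1) * a ≤ Real.exp (2 * (L + 1) * a) := by
      linarith [Real.add_one_le_exp (2 * (L + 1) * a)]
    rw [Real.exp_neg]
    have h3 : 0 < 1 + 2 * (L + 1) * a := by positivity
    refine (inv_anti₀ h3 h2).trans ?_
    rw [inv_le_iff_one_le_mul₀ h3]
    have h4 : 0 ≤ (L + 1) * a := by positivity
    nlinarith
  have hR1 : 0 ≤ η + M * (r - a) ^ 2 + 2 * e + 2 * (d + b * σ) := by positivity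
  have h5 : b * (Real.exp (2 * (L + 1) * t) *
      (η + M * (r - a) ^ 2 + 2 * e + 2 * (d + b * σ))) ≤
      b * ((1 - (L + 1) * a) * E * (η + M * (r - a) ^ 2 + 2 * e + 2 * (d + b * σ))) := by
    gcongr
  have h6 : a * b * (ρ + σ + η / 2 + M * r ^ 2) ≤
      E * (a * b * (ρ + σ + η / 2 + M * r ^ 2)) :=
    le_mul_of_one_le_left (by positivity) hE1
  have h7 : 0 ≤ (ρ + σ - 2 * ((L + 1) * a) * ρ) + (η / 2 - M * (a + b)
      - (L + 1) * (M * (2 * r * a - a ^ 2))) + 2 * e + 2 * d + 2 * a * ρ + 2 * b * σ := by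
    have i1 : 0 ≤ (1 - 2 * ((L + 1) * a)) * ρ := mul_nonneg (by linarith) hρ
    have i2 : M * (a + b) ≤ M * (2 * ε) := by gcongr; linarith
    have i3 : (L + 1) * (M * (2 * r * a - a ^ 2)) ≤ (L + 1) * (M * (2 * T * ε)) := by
      have : r * a ≤ T * ε := by
        have := abs_le.1 hr
        have hT : 0 ≤ T := (abs_nonneg r).trans hr
        nlinarith
      gcongr
      nlinarith [sq_nonneg a]
    have i4 : 0 ≤ a * ρ := by positivity
    have i5 : 0 ≤ b * σ := by positivity
    linarith
  -- The terms `2 r a b` from the two shifted squares cancel. Of `K = L + 1`, the part `L` offsets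
  -- `-a b L`; the extra `1` absorbs `M r ^ 2` and leaves a surplus `η`. The factor `2` before `e`
  -- leaves a spare `ρ` to pay for `2 (L + 1) a ρ`.
  have h8 : (a + b - a * b * L) * (η + M * r ^ 2 + 2 * (e + a * ρ) + 2 * (d + b * σ)) -
      (b * ((1 - (L + 1) * a) * (η + M * (r - a) ^ 2 + 2 * e + 2 * (d + b * σ))) +
      a * (η + M * (r + b) ^ 2 + 2 * (e + a * ρ) + 2 * d) +
      a * b * (ρ + σ + η / 2 + M * r ^ 2)) = a * b * ((ρ + σ - 2 * ((L + 1) * a) * ρ) +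
      (η / 2 - M * (a + b) - (L + 1) * (M * (2 * r * a - a ^ 2))) + 2 * e + 2 * d +
      2 * a * ρ + 2 * b * σ) := by ring
  have h9 := mul_nonneg (mul_pos ha hb).le h7
  rw [← h8] at h9
  have h10 := mul_nonneg (show 0 ≤ E by linarith) h9
  linarith

end WeightedGraph

/-! ### Discretizations and mild solutions -/

namespace WeightedGraph

variable {X : Type*} {G : WeightedGraph X} {p : ℝ} [hp : Fact (1 ≤ p)]

namespace EpsDiscretization

variable {T ε : ℝ} {h : ℝ → G.Ell p} (D : G.EpsDiscretization T h ε)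

theorem t_mono {i j : ℕ} (hij : i ≤ j) (hj : j ≤ D.N) : D.t i ≤ D.t j := by
  induction j, hij using Nat.le_induction with
  | base => exact le_rfl
  | succ j _ ih => exact (ih (by omega)).trans (D.t_lt j hj).le

theorem t_nonneg {i : ℕ} (hi : i ≤ D.N) : 0 ≤ D.t i :=
  D.t_zero ▸ D.t_mono (Nat.zero_le i) hi

theorem t_mem {i : ℕ} (hi : i ≤ D.N) : D.t i ∈ Icc 0 T :=
  ⟨D.t_nonneg hi, (D.t_mono hi le_rfl).trans D.t_le⟩

theorem exists_abs_sub_le {τ : ℝ} (hτ : τ ∈ Icc 0 T) : ∃ i ≤ D.N, |D.t i - τ| ≤ ε := by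
  rcases le_or_gt (D.t D.N) τ with h1 | h1
  · refine ⟨D.N, le_rfl, ?_⟩
    rw [abs_of_nonpos (by linarith)]
    linarith [D.last_le, hτ.2]
  have key : ∀ n ≤ D.N, τ < D.t n → ∃ k, k < n ∧ D.t k ≤ τ ∧ τ < D.t (k + 1) := by
    intro n
    induction n with
    | zero => intro _ h; rw [D.t_zero] at h; exact absurd hτ.1 (not_le.2 h)
    | succ n ih =>
      intro hn h
      rcases le_or_gt (D.t n) τ with h2 | h2
      · exact ⟨n, by omega, h2, h⟩
      · obtain ⟨k, hk, hk'⟩ := ih (by omega) h2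
        exact ⟨k, by omega, hk'⟩
  obtain ⟨k, hk, h2, h3⟩ := key D.N le_rfl h1
  refine ⟨k, hk.le, ?_⟩
  rw [abs_of_nonpos (by linarith)]
  linarith [D.step_le k hk]

theorem interpolant_t (uk : ℕ → G.Ell p) {i : ℕ} (hi : i ≤ D.N) :
    G.interpolant D uk (D.t i) = uk i := by
  rcases Nat.eq_zero_or_pos i with rfl | hpos
  · rw [interpolant, if_pos D.t_zero]
  obtain ⟨k, rfl⟩ : ∃ k, i = k + 1 := ⟨i - 1, by omega⟩
  have hpos : 0 < D.t (k + 1) := (D.t_nonneg (by omega)).trans_lt (D.t_lt k hi)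
  rw [interpolant, if_neg hpos.ne', Finset.sum_eq_single k]
  · exact indicator_of_mem (right_mem_Ioc.2 (D.t_lt k hi)) _
  · intro j hj hjk
    rw [Finset.mem_range] at hj
    refine indicator_of_notMem (fun hmem => ?_) _
    rcases lt_or_gt_of_ne hjk with h1 | h1
    · exact absurd (hmem.2.trans (D.t_mono h1 (by omega))) (not_le.2 (D.t_lt k hi))
    · exact absurd hmem.1 (not_lt.2 (D.t_mono h1 (by omega)))
  · intro hk
    exact absurd (Finset.mem_range.2 hi) hk

/-- The accumulated error of a discretization. -/
theorem sum_mul_le (hh : IntegrableOn h (Icc 0 T)) {φ : ℝ → ℝ} (hφ : IntegrableOn φ (Icc 0 T))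
    (hφ0 : ∀ s, 0 ≤ φ s) {ω : ℝ} (hω : 0 ≤ ω) {σ : ℕ → ℝ} (hσ0 : ∀ j, 0 ≤ σ j)
    (hσ : ∀ j < D.N, ∀ᵐ s ∂volume.restrict (Icc 0 T), s ∈ Ioc (D.t j) (D.t (j + 1)) →
      σ j ≤ ‖h s - D.hd (j + 1)‖ + φ s + ω) {n : ℕ} (hn : n ≤ D.N) :
    ∑ j ∈ Finset.range n, (D.t (j + 1) - D.t j) * σ j ≤
      ε + (∫ s in Icc 0 T, φ s) + T * ω := by
  have hsub : ∀ j < D.N, Ioc (D.t j) (D.t (j + 1)) ⊆ Icc 0 T := fun j hj s hs =>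
    ⟨(D.t_nonneg hj.le).trans hs.1.le, hs.2.trans (D.t_mem hj).2⟩
  have hφi : ∀ j < D.N, IntervalIntegrable φ volume (D.t j) (D.t (j + 1)) := fun j hj =>
    (intervalIntegrable_iff_integrableOn_Ioc_of_le (D.t_lt j hj).le).2
      (hφ.mono_set (hsub j hj))
  have hhi : ∀ j < D.N, IntervalIntegrable (fun s => ‖h s - D.hd (j + 1)‖) volume
      (D.t j) (D.t (j + 1)) := fun j hj =>
    (((intervalIntegrable_iff_integrableOn_Ioc_of_le (D.t_lt j hj).le).2
      (hh.mono_set (hsub j hj))).sub intervalIntegrable_const).norm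
  have hstep : ∀ j ∈ Finset.range D.N, (D.t (j + 1) - D.t j) * σ j ≤
      (∫ s in D.t j..D.t (j + 1), ‖h s - D.hd (j + 1)‖) + (∫ s in D.t j..D.t (j + 1), φ s) +
        (D.t (j + 1) - D.t j) * ω := by
    intro j hj
    rw [Finset.mem_range] at hj
    have hlt := D.t_lt j hj
    have h1 : ∫ s in D.t j..D.t (j + 1), σ j ≤
        ∫ s in D.t j..D.t (j + 1), (‖h s - D.hd (j + 1)‖ + φ s + ω) := by
      rw [intervalIntegral.integral_of_le hlt.le, intervalIntegral.integral_of_le hlt.le]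
      refine setIntegral_mono_on_ae (by simp) ?_ measurableSet_Ioc ?_
      · exact (((hhi j hj).add (hφi j hj)).add intervalIntegrable_const).1
      · have := (ae_restrict_iff' measurableSet_Icc).1 (hσ j hj)
        filter_upwards [this] with s hs hmem using hs (hsub j hj hmem) hmem
    rw [intervalIntegral.integral_add ((hhi j hj).add (hφi j hj)) intervalIntegrable_const,
      intervalIntegral.integral_add (hhi j hj) (hφi j hj), intervalIntegral.integral_const,
      intervalIntegral.integral_const, smul_eq_mul, smul_eq_mul] at h1
    exact h1
  have hφsum : ∑ j ∈ Finset.range D.N, ∫ s in D.t j..D.t (j + 1), φ s ≤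
      ∫ s in Icc 0 T, φ s := by
    rw [intervalIntegral.sum_integral_adjacent_intervals hφi,
      intervalIntegral.integral_of_le (D.t_mono (Nat.zero_le _) le_rfl)]
    refine setIntegral_mono_set hφ (ae_of_all _ hφ0) (LE.le.eventuallyLE ?_)
    intro s hs
    exact ⟨(D.t_nonneg (Nat.zero_le _)).trans hs.1.le, hs.2.trans D.t_le⟩
  calc ∑ j ∈ Finset.range n, (D.t (j + 1) - D.t j) * σ j
      ≤ ∑ j ∈ Finset.range D.N, (D.t (j + 1) - D.t j) * σ j := by
        refine Finset.sum_le_sum_of_subset_of_nonneg (Finset.range_mono hn) fun j hj _ => ?_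
        exact mul_nonneg (sub_pos.2 (D.t_lt j (Finset.mem_range.1 hj))).le (hσ0 j)
    _ ≤ _ := Finset.sum_le_sum hstep
    _ ≤ _ := by
        rw [Finset.sum_add_distrib, Finset.sum_add_distrib, ← Finset.sum_mul,
          Finset.sum_range_sub, D.t_zero, sub_zero]
        have := mul_le_mul_of_nonneg_right D.t_le hω
        linarith [D.sum_le]

end EpsDiscretization

/-- A quadratic modulus of continuity, chosen because the recursion can be verified on squares by
pure algebra. Uniform continuity handles close times; for distant ones `M` is the bound `2 |B|`
divided by `δ ^ 2`. -/
theorem exists_norm_sub_le_add_mul_sq {E : Type*} [NormedAddCommGroup E] {F : ℝ → E} {T : ℝ}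
    (hF : ContinuousOn F (Icc 0 T)) {η : ℝ} (hη : 0 < η) :
    ∃ M ≥ 0, ∀ s ∈ Icc 0 T, ∀ t ∈ Icc 0 T, ‖F t - F s‖ ≤ η + M * (t - s) ^ 2 := by
  obtain ⟨B, hB⟩ := isCompact_Icc.exists_bound_of_continuousOn hF
  obtain ⟨δ, hδ, hδF⟩ := Metric.uniformContinuousOn_iff.1
    (isCompact_Icc.uniformContinuousOn_of_continuous hF) η hη
  refine ⟨2 * |B| / δ ^ 2, by positivity, fun s hs t ht => ?_⟩
  rcases lt_or_ge (dist t s) δ with h | h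
  · have := (hδF t ht s hs h).le
    rw [dist_eq_norm] at this
    have h2 : 0 ≤ 2 * |B| / δ ^ 2 * (t - s) ^ 2 := by positivity
    linarith
  · have h1 : ‖F t - F s‖ ≤ 2 * |B| := by
      linarith [norm_sub_le (F t) (F s), hB t ht, hB s hs, le_abs_self B]
    have h2 : δ ^ 2 ≤ (t - s) ^ 2 := by
      rw [Real.dist_eq] at h
      rw [← sq_abs (t - s)]
      gcongr
    have h3 : 2 * |B| ≤ 2 * |B| / δ ^ 2 * (t - s) ^ 2 := by
      rw [div_mul_eq_mul_div, le_div_iff₀ (by positivity)]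
      gcongr
    linarith

/-- The inequality relating two implicit Euler steps of different length. -/
theorem posNorm_sub_le_of_euler_steps (hIP : G.CondIP) {f : ℝ → ℝ} {L : ℝ}
    (hf : ∀ a b, b ≤ a → f a - f b ≤ L * (a - b)) {u u' h v v' g : G.Ell p}
    (hu : G.MemDomA f u') (hv : G.MemDomA f v') {a b : ℝ} (ha : 0 < a) (hb : 0 < b)
    (hab : a * b * L < a + b) (hue : ∀ x, u' x + a * G.opA f u' x = u x + a * h x)
    (hve : ∀ x, v' x + b * G.opA f v' x = v x + b * g x) :
    (a + b - a * b * L) * (u' - v').posNorm ≤ b * (u - v').posNorm + a * (u' - v).posNorm +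
      a * b * (h - g).posNorm := by
  have hs : 0 < a + b := by linarith
  have hθ : 0 < a * b / (a + b) := by positivity
  -- For `θ = a b / (a + b)` the terms `u'` and `v'` left over from the two Euler equations regroup
  -- into the mixed differences `u - v'` and `u' - v`, with weights `b` and `a`.
  have key := posNorm_sub_le_of_condIP hIP hf hu.1 hv.1 hθ
    (by rw [div_mul_eq_mul_div, div_lt_one hs]; exact hab)
    (F := (a + b)⁻¹ • (b • (u - v') + a • (u' - v) + (a * b) • (h - g))) (fun x => by
      have h1 : G.opA f u' x = (u x + a * h x - u' x) / a := by
        rw [eq_div_iff ha.ne']; linarith [hue x]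
      have h2 : G.opA f v' x = (v x + b * g x - v' x) / b := by
        rw [eq_div_iff hb.ne']; linarith [hve x]
      simp only [Ell.coe_smul, Ell.coe_add, Ell.coe_sub]
      rw [h1, h2]
      field_simp
      ring)
  rw [Ell.posNorm_smul (inv_nonneg.2 hs.le), ← div_eq_inv_mul, le_div_iff₀ hs] at key
  have h1 : (1 - a * b / (a + b) * L) * (u' - v').posNorm * (a + b) =
      (a + b - a * b * L) * (u' - v').posNorm := by
    field_simp
  rw [h1] at key
  refine key.trans ((Ell.posNorm_add_le _ _).trans ?_)
  rw [Ell.posNorm_smul (mul_pos ha hb).le]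
  refine add_le_add_left ((Ell.posNorm_add_le _ _).trans ?_) _
  rw [Ell.posNorm_smul hb.le, Ell.posNorm_smul ha.le]

theorem IsMildSolutionOn.initial {f : ℝ → ℝ} {T : ℝ} {h : ℝ → G.Ell p} {u₀ : G.Ell p}
    {u : ℝ → G.Ell p} (hu : G.IsMildSolutionOn f T h u₀ u) : u 0 = u₀ := by
  rw [← sub_eq_zero, ← norm_le_zero_iff]
  refine le_of_forall_pos_lt_add fun ε hε => ?_
  obtain ⟨D, uk, hD, huk⟩ := hu.2 ε hε
  have := huk (D.t 0) ⟨D.t_nonneg (Nat.zero_le _), D.t_mono (Nat.zero_le _) le_rfl⟩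
  rw [D.interpolant_t uk (Nat.zero_le _), hD.1, D.t_zero] at this
  simpa using this

/-- The constant does not depend on `η`, so the estimate forces the left side to be zero. -/
theorem posNorm_sub_le_mul (hIP : G.CondIP) {f : ℝ → ℝ} {L : ℝ} (hL : 0 ≤ L)
    (hf : ∀ a b, b ≤ a → f a - f b ≤ L * (a - b)) {T : ℝ} {h g : ℝ → G.Ell p}
    (hh : IntegrableOn h (Icc 0 T)) (hg : IntegrableOn g (Icc 0 T)) {u₀ v₀ : G.Ell p}
    {u v : ℝ → G.Ell p} (hu : G.IsMildSolutionOn f T h u₀ u)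
    (hv : G.IsMildSolutionOn f T g v₀ v) (h₀ : ∀ x, u₀ x ≤ v₀ x)
    (hle : ∀ᵐ t ∂(volume.restrict (Icc 0 T)), ∀ x, h t x ≤ g t x) {τ : ℝ} (hτ : τ ∈ Icc 0 T)
    {η : ℝ} (hη : 0 < η) (hη1 : η ≤ 1) :
    (u τ - v τ).posNorm ≤ (Real.exp (2 * (L + 1) * T) * (10 + 4 * T) + 3) * η := by
  have hT : 0 ≤ T := hτ.1.trans hτ.2
  -- a continuous approximation of `h`
  obtain ⟨hc, -, hc1, hc2, hc3⟩ := hh.exists_hasCompactSupport_integral_sub_le hη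
  have hφ : IntegrableOn (fun s => ‖h s - hc s‖) (Icc 0 T) := (hh.sub hc3).norm
  -- moduli of continuity
  obtain ⟨M₁, hM₁, hcM⟩ := exists_norm_sub_le_add_mul_sq (T := T) hc2.continuousOn (half_pos hη)
  obtain ⟨M₂, hM₂, huM⟩ := exists_norm_sub_le_add_mul_sq hu.1 (half_pos hη)
  obtain ⟨M₃, hM₃, hvM⟩ := exists_norm_sub_le_add_mul_sq hv.1 (half_pos hη)
  obtain ⟨M, hM, hM1, hM2, hM3⟩ : ∃ M ≥ 0, M₁ ≤ M ∧ M₂ ≤ M ∧ M₃ ≤ M :=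
    ⟨M₁ + M₂ + M₃, by positivity, by linarith, by linarith, by linarith⟩
  replace hcM : ∀ s ∈ Icc 0 T, ∀ t ∈ Icc 0 T, ‖hc t - hc s‖ ≤ η / 2 + M * (t - s) ^ 2 :=
    fun s hs t ht => (hcM s hs t ht).trans (by gcongr)
  replace huM : ∀ s ∈ Icc 0 T, ∀ t ∈ Icc 0 T, ‖u t - u s‖ ≤ η / 2 + M * (t - s) ^ 2 :=
    fun s hs t ht => (huM s hs t ht).trans (by gcongr)
  replace hvM : ∀ s ∈ Icc 0 T, ∀ t ∈ Icc 0 T, ‖v t - v s‖ ≤ η / 2 + M * (t - s) ^ 2 :=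
    fun s hs t ht => (hvM s hs t ht).trans (by gcongr)
  -- the fineness of the discretizations
  obtain ⟨ε, hε, hεη, hεL, hεM⟩ : ∃ ε > 0, ε ≤ η / 2 ∧ 2 * (L + 1) * ε ≤ 1 ∧
      2 * M * ε * (1 + (L + 1) * T) ≤ η / 2 := by
    have hQ : 0 < 2 * (L + 1) + 2 * M * (1 + (L + 1) * T) + 1 := by positivity
    refine ⟨η / 2 / (2 * (L + 1) + 2 * M * (1 + (L + 1) * T) + 1), by positivity, ?_, ?_, ?_⟩
    · have : 0 ≤ 2 * (L + 1) + 2 * M * (1 + (L + 1) * T) := by positivity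
      exact div_le_self (by positivity) (by linarith)
    · rw [← mul_div_assoc, div_le_one hQ]
      have : 0 ≤ 2 * M * (1 + (L + 1) * T) := by positivity
      nlinarith
    · rw [mul_right_comm, ← mul_div_assoc, div_le_iff₀ hQ]
      have : 0 ≤ η / 2 * (2 * (L + 1) + 1) := by positivity
      nlinarith
  have hMε : M * ε ≤ η / 4 := by
    have : 0 ≤ M * ε * ((L + 1) * T) := by positivity
    linarith
  -- Here `ε ≤ 1` is used, which is where `η ≤ 1` enters.
  have hMsq : ∀ r, |r| ≤ ε → M * r ^ 2 ≤ η / 4 := by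
    intro r hr
    rw [← sq_abs]
    calc M * |r| ^ 2 ≤ M * ε ^ 2 := by gcongr
      _ = M * ε * ε := by ring
      _ ≤ M * ε * 1 := by gcongr; linarith
      _ ≤ η / 4 := by linarith
  obtain ⟨D, uk, hDu, huk⟩ := hu.2 ε hε
  obtain ⟨D', vk, hDv, hvk⟩ := hv.2 ε hε
  have hukt : ∀ i ≤ D.N, ‖u (D.t i) - uk i‖ ≤ ε := fun i hi => by
    rw [← D.interpolant_t uk hi]
    exact (huk _ ⟨D.t_nonneg hi, D.t_mono hi le_rfl⟩).le
  have hvkt : ∀ j ≤ D'.N, ‖v (D'.t j) - vk j‖ ≤ ε := fun j hj => by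
    rw [← D'.interpolant_t vk hj]
    exact (hvk _ ⟨D'.t_nonneg hj, D'.t_mono hj le_rfl⟩).le
  let a : ℕ → ℝ := fun i => D.t (i + 1) - D.t i
  let b : ℕ → ℝ := fun j => D'.t (j + 1) - D'.t j
  let ρ : ℕ → ℝ := fun i => ‖D.hd (i + 1) - hc (D.t (i + 1))‖
  -- Only the positive part is measured here: on passing from `hc` to the data of `g`, the
  -- difference `h - g ≤ 0` then contributes nothing.
  let σ : ℕ → ℝ := fun j => (hc (D'.t (j + 1)) - D'.hd (j + 1)).posNorm
  let e : ℕ → ℝ := fun n => ∑ i ∈ Finset.range n, a i * ρ i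
  let d : ℕ → ℝ := fun n => ∑ j ∈ Finset.range n, b j * σ j
  have ha : ∀ i < D.N, 0 < a i := fun i hi => sub_pos.2 (D.t_lt i hi)
  have hb : ∀ j < D'.N, 0 < b j := fun j hj => sub_pos.2 (D'.t_lt j hj)
  have hρ : ∀ i, 0 ≤ ρ i := fun i => norm_nonneg _
  have hσ : ∀ j, 0 ≤ σ j := fun j => Ell.posNorm_nonneg _
  have he0 : ∀ n ≤ D.N, 0 ≤ e n := fun n hn => Finset.sum_nonneg fun i hi =>
    mul_nonneg (ha i ((Finset.mem_range.1 hi).trans_le hn)).le (hρ i)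
  have hd0 : ∀ n ≤ D'.N, 0 ≤ d n := fun n hn => Finset.sum_nonneg fun j hj =>
    mul_nonneg (hb j ((Finset.mem_range.1 hj).trans_le hn)).le (hσ j)
  have hce : ∀ s ∈ Icc 0 T, ∀ t ∈ Icc 0 T, |t - s| ≤ ε → ‖hc t - hc s‖ ≤ η :=
    fun s hs t ht hst => by linarith [hcM s hs t ht, hMsq _ hst]
  -- `ε ≤ η / 2` from the discretization, `η` from approximating `h` by `hc`, and `T η` from the
  -- oscillation of `hc` within a step.
  have he : ∀ n ≤ D.N, e n ≤ (2 + T) * η := fun n hn => by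
    have := D.sum_mul_le hh hφ (fun s => norm_nonneg _) hη.le hρ (fun i hi => by
      filter_upwards [ae_restrict_mem measurableSet_Icc] with s hsT hs
      have h1 := hce (D.t (i + 1)) (D.t_mem hi) s hsT
        (by rw [abs_le]; constructor <;> linarith [hs.1, hs.2, D.step_le i hi])
      have h2 : D.hd (i + 1) - hc (D.t (i + 1)) = (D.hd (i + 1) - h s) + (h s - hc s) +
        (hc s - hc (D.t (i + 1))) := by abel
      have h3 := norm_add₃_le (a := D.hd (i + 1) - h s) (b := h s - hc s)
        (c := hc s - hc (D.t (i + 1)))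
      rw [← h2, norm_sub_rev (D.hd (i + 1)) (h s)] at h3
      exact h3.trans (by linarith)) hn
    linarith
  have hd : ∀ n ≤ D'.N, d n ≤ (2 + T) * η := fun n hn => by
    have := D'.sum_mul_le hg hφ (fun s => norm_nonneg _) hη.le hσ (fun j hj => by
      filter_upwards [ae_restrict_mem measurableSet_Icc, hle] with s hsT hhg hs
      have h1 := hce s hsT (D'.t (j + 1)) (D'.t_mem hj)
        (by rw [abs_le]; constructor <;> linarith [hs.1, hs.2, D'.step_le j hj])
      have h2 : hc (D'.t (j + 1)) - D'.hd (j + 1) = (h s - g s) + ((g s - D'.hd (j + 1)) +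
        (hc s - h s) + (hc (D'.t (j + 1)) - hc s)) := by abel
      have h3 := Ell.posNorm_add_le (h s - g s) ((g s - D'.hd (j + 1)) +
        (hc s - h s) + (hc (D'.t (j + 1)) - hc s))
      have h0 : (h s - g s).posNorm = 0 :=
        Ell.posNorm_eq_zero_iff.2 fun x => sub_nonpos.2 (hhg x)
      rw [← h2, h0, zero_add] at h3
      have h4 := (Ell.posNorm_le_norm _).trans (norm_add₃_le (a := g s - D'.hd (j + 1))
        (b := hc s - h s) (c := hc (D'.t (j + 1)) - hc s))
      rw [norm_sub_rev (hc s) (h s)] at h4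
      exact h3.trans (by linarith)) hn
    linarith
  have hexp : ∀ i ≤ D.N, 1 ≤ Real.exp (2 * (L + 1) * D.t i) := fun i hi =>
    Real.one_le_exp (mul_nonneg (by linarith) (D.t_nonneg hi))
  have h00 : (u 0 - v 0).posNorm = 0 := Ell.posNorm_eq_zero_iff.2 fun x => by
    rw [hu.initial, hv.initial, Ell.coe_sub]; linarith [h₀ x]
  have h0T : (0 : ℝ) ∈ Icc 0 T := ⟨le_rfl, hT⟩
  have haL : ∀ i < D.N, a i * L ≤ 1 / 2 := fun i hi => by
    have : a i ≤ ε := D.step_le i hi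
    nlinarith
  have hab : ∀ i < D.N, ∀ j < D'.N, a i * b j * L < a i + b j := fun i hi j hj => by
    nlinarith [haL i hi, ha i hi, hb j hj]
  -- comparison of the two schemes
  have grid := le_of_double_recursion (L := L)
    (ψ := fun i j => (uk i - vk j).posNorm)
    (Φ := fun i j => Real.exp (2 * (L + 1) * D.t i) *
      (η + M * (D.t i - D'.t j) ^ 2 + 2 * e i + 2 * d j))
    (H := fun i j => ρ i + σ j + η / 2 + M * (D.t (i + 1) - D'.t (j + 1)) ^ 2)
    ha hb (fun i hi j hj => by linarith [hab i hi j hj])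
    -- On the edges of the grid one scheme sits at its initial value. `u 0 ≤ v 0` removes the
    -- initial difference, leaving the approximation error and the time modulus.
    (fun i hi => by
      have h1 : uk i - vk 0 = (u 0 - v 0) + ((uk i - u (D.t i)) + (u (D.t i) - u 0)) := by
        rw [hDv.1, ← hv.initial]; abel
      have h2 := Ell.posNorm_add_le (u 0 - v 0) ((uk i - u (D.t i)) + (u (D.t i) - u 0))
      rw [← h1, h00, zero_add] at h2
      have h3 := (Ell.posNorm_le_norm _).trans
        (norm_add_le (uk i - u (D.t i)) (u (D.t i) - u 0))
      have h4 := hukt i hi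
      rw [norm_sub_rev] at h4
      have h5 := huM 0 h0T _ (D.t_mem hi)
      have h6 := he0 i hi
      have h7 := hd0 0 (Nat.zero_le _)
      have h8 : 0 ≤ M * (D.t i - 0) ^ 2 := by positivity
      rw [D'.t_zero]
      exact le_trans (by linarith) (le_mul_of_one_le_left (by linarith) (hexp i hi)))
    (fun j hj => by
      have h1 : uk 0 - vk j = (u 0 - v 0) + ((v 0 - v (D'.t j)) + (v (D'.t j) - vk j)) := by
        rw [hDu.1, ← hu.initial]; abel
      have h2 := Ell.posNorm_add_le (u 0 - v 0) ((v 0 - v (D'.t j)) + (v (D'.t j) - vk j))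
      rw [← h1, h00, zero_add] at h2
      have h3 := (Ell.posNorm_le_norm _).trans
        (norm_add_le (v 0 - v (D'.t j)) (v (D'.t j) - vk j))
      have h4 := hvkt j hj
      have h5 := hvM _ (D'.t_mem hj) 0 h0T
      have h6 := he0 0 (Nat.zero_le _)
      have h7 := hd0 j hj
      have h8 : 0 ≤ M * (0 - D'.t j) ^ 2 := by positivity
      have h9 := hexp 0 (Nat.zero_le _)
      rw [D.t_zero] at h9 ⊢
      exact le_trans (by linarith) (le_mul_of_one_le_left (by linarith) h9))
    (fun i hi j hj => by
      refine (posNorm_sub_le_of_euler_steps hIP hf (hDu.2 i hi).1 (hDv.2 j hj).1 (ha i hi)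
        (hb j hj) (hab i hi j hj) (hDu.2 i hi).2 (hDv.2 j hj).2).trans ?_
      have hpos := mul_pos (ha i hi) (hb j hj)
      gcongr
      have h1 : D.hd (i + 1) - D'.hd (j + 1) = (D.hd (i + 1) - hc (D.t (i + 1)) +
        (hc (D.t (i + 1)) - hc (D'.t (j + 1)))) + (hc (D'.t (j + 1)) - D'.hd (j + 1)) := by abel
      have h2 := Ell.posNorm_add_le (D.hd (i + 1) - hc (D.t (i + 1)) +
        (hc (D.t (i + 1)) - hc (D'.t (j + 1)))) (hc (D'.t (j + 1)) - D'.hd (j + 1))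
      rw [← h1] at h2
      have h3 := (Ell.posNorm_le_norm _).trans (norm_add_le (D.hd (i + 1) - hc (D.t (i + 1)))
        (hc (D.t (i + 1)) - hc (D'.t (j + 1))))
      have h4 := hcM _ (D'.t_mem hj) _ (D.t_mem hi)
      simp only [ρ, σ]
      linarith)
    (fun i hi j hj => by
      have hi' := D.t_mem (Nat.succ_le_of_lt hi)
      have hj' := D'.t_mem (Nat.succ_le_of_lt hj)
      have key := supersolution_step (r := D.t (i + 1) - D'.t (j + 1)) (T := T) (e := e i)
        (d := d j) hL hM (ha i hi) (hb j hj) (D.step_le i hi) (D'.step_le j hj)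
        (D.t_nonneg hi.le) (by rw [abs_le]; constructor <;> linarith [hi'.1, hi'.2, hj'.1, hj'.2])
        hη.le (hρ i) (hσ j) (he0 i hi.le) (hd0 j hj.le) hεL hεM
      have h1 : D.t i + a i = D.t (i + 1) := by simp [a]
      have h2 : D.t (i + 1) - D'.t (j + 1) - a i = D.t i - D'.t (j + 1) := by simp only [a]; ring
      have h3 : D.t (i + 1) - D'.t (j + 1) + b j = D.t (i + 1) - D'.t j := by simp only [b]; ring
      have h4 : e i + a i * ρ i = e (i + 1) := (Finset.sum_range_succ _ _).symm
      have h5 : d j + b j * σ j = d (j + 1) := (Finset.sum_range_succ _ _).symm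
      rwa [h1, h2, h3, h4, h5] at key)
  obtain ⟨i, hi, hiτ⟩ := D.exists_abs_sub_le hτ
  obtain ⟨j, hj, hjτ⟩ := D'.exists_abs_sub_le hτ
  -- `η + η + 2 (2 + T) η + 2 (2 + T) η = (10 + 4 T) η`.
  have hij : (uk i - vk j).posNorm ≤ Real.exp (2 * (L + 1) * T) * ((10 + 4 * T) * η) := by
    refine (grid i hi j hj).trans ?_
    have h1 : M * (D.t i - D'.t j) ^ 2 ≤ η := by
      have h2 : (D.t i - D'.t j) ^ 2 ≤ 2 * (D.t i - τ) ^ 2 + 2 * (D'.t j - τ) ^ 2 := by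
        nlinarith [sq_nonneg (D.t i - τ + (D'.t j - τ))]
      nlinarith [hMsq _ hiτ, hMsq _ hjτ]
    have h3 := he i hi
    have h4 := hd j hj
    have h5 := he0 i hi
    have h6 := hd0 j hj
    have h7 := (D.t_mem hi).2
    have h8 : 0 ≤ M * (D.t i - D'.t j) ^ 2 := by positivity
    refine mul_le_mul (Real.exp_le_exp.2 (by gcongr)) (by linarith) (by linarith)
      (Real.exp_pos _).le
  have h1 : ‖(u τ - v τ) - (uk i - vk j)‖ ≤ 3 * η := by
    have h2 : (u τ - v τ) - (uk i - vk j) = ((u τ - u (D.t i)) + (u (D.t i) - uk i)) -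
      ((v τ - v (D'.t j)) + (v (D'.t j) - vk j)) := by abel
    rw [h2]
    refine (norm_sub_le _ _).trans ?_
    have h3 := norm_add_le (u τ - u (D.t i)) (u (D.t i) - uk i)
    have h4 := norm_add_le (v τ - v (D'.t j)) (v (D'.t j) - vk j)
    rw [abs_sub_comm] at hiτ hjτ
    linarith [huM _ (D.t_mem hi) τ hτ, hvM _ (D'.t_mem hj) τ hτ, hMsq _ hiτ, hMsq _ hjτ,
      hukt i hi, hvkt j hj]
  linarith [Ell.posNorm_le_add_norm_sub (u τ - v τ) (uk i - vk j)]

/-- Comparison principle for mild solutions on a compact time interval. -/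
theorem IsMildSolutionOn.le_of_le (hIP : G.CondIP) {f : ℝ → ℝ} {L : ℝ} (hL : 0 ≤ L)
    (hf : ∀ a b, b ≤ a → f a - f b ≤ L * (a - b)) {T : ℝ} {h g : ℝ → G.Ell p}
    (hh : IntegrableOn h (Icc 0 T)) (hg : IntegrableOn g (Icc 0 T)) {u₀ v₀ : G.Ell p}
    {u v : ℝ → G.Ell p} (hu : G.IsMildSolutionOn f T h u₀ u)
    (hv : G.IsMildSolutionOn f T g v₀ v) (h₀ : ∀ x, u₀ x ≤ v₀ x)
    (hle : ∀ᵐ t ∂(volume.restrict (Icc 0 T)), ∀ x, h t x ≤ g t x) {τ : ℝ} (hτ : τ ∈ Icc 0 T)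
    (x : X) : u τ x ≤ v τ x := by
  have hT : 0 ≤ T := hτ.1.trans hτ.2
  have hC : 0 < Real.exp (2 * (L + 1) * T) * (10 + 4 * T) + 3 := by positivity
  have hzero : (u τ - v τ).posNorm = 0 := by
    refine le_antisymm (le_of_forall_pos_le_add fun δ hδ => ?_) (Ell.posNorm_nonneg _)
    refine (posNorm_sub_le_mul hIP hL hf hh hg hu hv h₀ hle hτ
      (lt_min one_pos (div_pos hδ hC)) (min_le_left _ _)).trans ?_
    rw [zero_add]
    exact (mul_le_mul_of_nonneg_left (min_le_right _ _) hC.le).trans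
      (mul_div_cancel₀ _ hC.ne').le
  have := Ell.posNorm_eq_zero_iff.1 hzero x
  rw [Ell.coe_sub] at this
  linarith

end WeightedGraph

/-! ### Reduction to a one-sided Lipschitz bound and a compact interval -/

theorem exists_one_sided_lipschitz {f : ℝ → ℝ} (hf : CondF1 f ∨ CondF2 f) :
    ∃ L ≥ 0, ∀ a b, b ≤ a → f a - f b ≤ L * (a - b) := by
  rcases hf with ⟨-, hanti, -⟩ | ⟨⟨L, -, hL⟩, -⟩
  · exact ⟨0, le_rfl, fun a b hab => by linarith [hanti hab]⟩
  · refine ⟨L, L.2, fun a b hab => ?_⟩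
    have := hL.dist_le_mul a b
    rw [Real.dist_eq, Real.dist_eq, abs_of_nonneg (sub_nonneg.2 hab)] at this
    exact (le_abs_self _).trans this

theorem exists_Icc_subset_timeInterval {T : WithTop ℝ} {t : ℝ} (ht : t ∈ timeInterval T) :
    ∃ a : ℝ, t ≤ a ∧ Icc 0 a ⊆ timeInterval T ∧ (T = a ∨ T = ⊤ ∧ 0 < a) := by
  induction T using WithTop.recTopCoe with
  -- `t + 1` rather than `t`: for `T = ⊤` the solution property is given only on `[0, a]` with `a >
  -- 0`, and `t` may be `0`.
  | top => exact ⟨t + 1, by linarith, fun s hs => ⟨hs.1, le_top⟩, Or.inr ⟨rfl, by linarith [ht.1]⟩⟩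
  | coe a =>
    exact ⟨a, WithTop.coe_le_coe.1 ht.2, fun s hs => ⟨hs.1, WithTop.coe_le_coe.2 hs.2⟩,
      Or.inl rfl⟩

theorem WeightedGraph.IsMildSolution.isMildSolutionOn {X : Type*} {G : WeightedGraph X} {p : ℝ}
    [Fact (1 ≤ p)] {f : ℝ → ℝ} {T : WithTop ℝ} {h : ℝ → G.Ell p} {u₀ : G.Ell p}
    {u : ℝ → G.Ell p} (hu : G.IsMildSolution f T h u₀ u) {a : ℝ}
    (ha : T = a ∨ T = ⊤ ∧ 0 < a) : G.IsMildSolutionOn f a h u₀ u :=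
  ha.elim (hu.1 a) fun h => hu.2 h.1 a h.2

end

theorem theorem6p1 {X : Type*} [Countable X] (G : WeightedGraph X)
    (hconn : G.IsConnected) (hIP : G.CondIP)
    (p : ℝ) [Fact (1 ≤ p)] (hCp : 1 < p → G.CondC p)
    (f : ℝ → ℝ) (hf : CondF1 f ∨ CondF2 f)
    (T : WithTop ℝ) (hT : 0 < T)
    (h g : ℝ → G.Ell p)
    (hh : LocallyIntegrableOn h (timeInterval T) volume)
    (hg : LocallyIntegrableOn g (timeInterval T) volume)
    (u₀ v₀ : G.Ell p) (u v : ℝ → G.Ell p)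
    (hu : G.IsMildSolution f T h u₀ u) (hv : G.IsMildSolution f T g v₀ v)
    (h₀ : ∀ x, u₀ x ≤ v₀ x)
    (hle : ∀ᵐ t ∂(volume.restrict (timeInterval T)), ∀ x, h t x ≤ g t x) :
    ∀ t ∈ timeInterval T, ∀ x, u t x ≤ v t x := by
  intro t ht x
  obtain ⟨L, hL, hfL⟩ := exists_one_sided_lipschitz hf
  obtain ⟨a, hta, hsub, ha⟩ := exists_Icc_subset_timeInterval ht
  exact (hu.isMildSolutionOn ha).le_of_le hIP hL hfL
    (hh.integrableOn_compact_subset hsub isCompact_Icc)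
    (hg.integrableOn_compact_subset hsub isCompact_Icc) (hv.isMildSolutionOn ha) h₀
    (ae_restrict_of_ae_restrict_of_subset hsub hle) ⟨ht.1, hta⟩ x
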